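/- Theorem 7.1. Let $T$ be a tree (a finite connected simple graph without cycles, with at least one vertex). Then $Z_{\pm}(T)=Z(T)$, where the two parameters are defined as follows for a finite simple graph $G$. *Classical zero forcing.* A set $S\subseteq V(G)$ is colored black and the other vertices white. Repeatedly, if a black vertex $u$ has exactly one white neighbour $w$, color $w$ black, until no more changes are possible; the result is the derived coloring of $S$. $S$ is a zero forcing set if all vertices are black in its derived coloring, and $Z(G)$ is the minimum size of a zero forcing set. *Signed zero forcing.* Let $P$ be a square sign pattern indexed by a finite set $V$, with entries in $\{+,-,0,?\}$ and $P_{ij}\ne\,?$ for $i\neq j$. Write $j\to i$ if $P_{ij}\in\{+,-\}$. Signs are multiplied as usual, and $\iota$ exchanges $+$ and $-$. During the game each vertex is either black or white, and a white vertex may carry a marker $m(w)\in\{+,-\}$ (put $m(w)=*$ if it carries none). At first the vertices of a set $S\subseteq V$ are black and all others are white and unmarked. For a vertex $u$ let $$W=\{w : w \text{ is white and } w\to u\},\qquad W_*=\{w\in W : m(w)=*\},$$ $$W_+=\{w\in W\setminus W_* : m(w)=P_{uw}\},\qquad W_-=\{w\in W\setminus W_* : m(w)\ne P_{uw}\}.$$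 (So $u\in W$ exactly when $u$ is white and $P_{uu}\in\{+,-\}$.) The moves are: (a) if $W=\{w\}$, color $w$ black; (b) if $W_+=W$ or $W_-=W$, color all vertices of $W$ black; (c) if $W_s\neq\emptyset$, $W_{\iota(s)}=\emptyset$ for some sign $s$, and $W_*=\{w\}$, mark $w$ with $P_{uw}\cdot\iota(s)$; (d) if no white vertex is marked, mark any one white vertex with $+$. Moves (a)–(c) may be made for a vertex $u$ that is black, or that is white with $P_{uu}\neq\,?$. A vertex that is colored black loses its marker. $S$ is a forcing set if some finite sequence of moves makes all vertices black, and $Z_\pm(P)$ is the minimum size of a forcing set. Finally $Z_\pm(G)=Z_\pm(P_{\mathcal Z}(G))$, where $P_{\mathcal Z}(G)$ is the sign pattern indexed by $V(G)$ with entry $?$ if $i=j$, $-$ if $i$ and $j$ are adjacent, and $0$ otherwise. -/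

import Mathlib

/-! ### Classical zero forcing -/

namespace SimpleGraph

variable {V : Type*}

/-- One application of the classical zero forcing rule; `B` is the set of black vertices before the
move and `B'` the set of black vertices after it: `w` is the unique white neighbour of a black
vertex `u`, and `w` becomes black. -/
def ZeroForcingStep (G : SimpleGraph V) (B B' : Set V) : Prop :=
  ∃ u ∈ B, ∃ w, {v | G.Adj u v ∧ v ∉ B} = {w} ∧ B' = insert w B

/-- `D` is the set of black vertices of a derived coloring of `S`: it is obtained from `S` by
finitely many applications of the rule, and no further application is possible. -/
def IsDerivedColoring (G : SimpleGraph V) (S D : Set V) : Prop :=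
  Relation.ReflTransGen G.ZeroForcingStep S D ∧ ∀ D', ¬ G.ZeroForcingStep D D'

/-- All vertices are black in the derived coloring of `S`. -/
def IsZeroForcingSet (G : SimpleGraph V) (S : Set V) : Prop :=
  G.IsDerivedColoring S Set.univ

/-- The zero forcing number `Z(G)`. -/
noncomputable def zeroForcingNumber (G : SimpleGraph V) : ℕ :=
  sInf {k | ∃ S : Finset V, G.IsZeroForcingSet (S : Set V) ∧ S.card = k}

end SimpleGraph

/-! ### Sign patterns -/

/-- The two signs: `1` is `+` and `-1` is `-`. Negation is the sign inversion, and the product of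
two signs is `+` exactly when they are equal. -/
abbrev Sgn : Type := ℤˣ

/-- An entry of a sign pattern: a sign, `0`, or `?`. -/
inductive PatternEntry : Type
  | sgn (s : Sgn)
  | zero
  | unknown

/-- A square sign pattern with fixed periphery, with rows and columns indexed by `V`. -/
structure SignPattern (V : Type*) where
  entry : V → V → PatternEntry
  fixed_periphery : ∀ i j, i ≠ j → entry i j ≠ PatternEntry.unknown

/-- The state of a vertex during the signed game: black, or white with an optional marker. -/
inductive VertexState : Type
  | black
  | white (marker : Option Sgn)

namespace SignPattern

variable {V : Type*}

/-- `j → i` in the signed digraph of `P`: the entry `P_{ij}` is `+` or `-`. -/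
def Arrow (P : SignPattern V) (j i : V) : Prop :=
  ∃ s : Sgn, P.entry i j = PatternEntry.sgn s

/-- The color-change rule may be applied to `u`: `u` is black, or `u` is white and `P_{uu} ≠ ?`. -/
def Applicable (P : SignPattern V) (c : V → VertexState) (u : V) : Prop :=
  c u = VertexState.black ∨
    ((∃ m, c u = VertexState.white m) ∧ P.entry u u ≠ PatternEntry.unknown)

/-- The set `W` of white vertices `w` with `w → u` (this includes `u` itself if it is white and
`P_{uu}` is `+` or `-`). -/
def whiteIn (P : SignPattern V) (c : V → VertexState) (u : V) : Set V :=
  {w | (∃ m, c w = VertexState.white m) ∧ P.Arrow w u}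

/-- The set `W_s`. For `s = +` it consists of the marked `w ∈ W` whose marker equals `P_{uw}`; for
`s = -` it consists of the marked `w ∈ W` whose marker differs from (is opposite to) `P_{uw}`. -/
def whiteInSigned (P : SignPattern V) (c : V → VertexState) (u : V) (s : Sgn) : Set V :=
  {w | w ∈ P.whiteIn c u ∧
    ∃ t : Sgn, c w = VertexState.white (some t) ∧ P.entry u w = PatternEntry.sgn (s * t)}

/-- The set `W_*` of unmarked vertices of `W`. -/
def whiteInUnmarked (P : SignPattern V) (c : V → VertexState) (u : V) : Set V :=
  {w | w ∈ P.whiteIn c u ∧ c w = VertexState.white none}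

open Classical in
/-- Color all vertices of `A` black (their markers disappear). -/
noncomputable def blacken (c : V → VertexState) (A : Set V) : V → VertexState :=
  fun v => if v ∈ A then VertexState.black else c v

open Classical in
/-- Mark the vertex `w` with the sign `s`. -/
noncomputable def mark (c : V → VertexState) (w : V) (s : Sgn) : V → VertexState :=
  fun v => if v = w then VertexState.white (some s) else c v

/-- One application of the signed zero forcing rule for `P`, from the state `c` to a new state. -/
inductive SignedStep (P : SignPattern V) (c : V → VertexState) : (V → VertexState) → Prop
  /-- If `W = {w}`, color `w` black. -/
  | force (u w : V) (hu : P.Applicable c u) (hW : P.whiteIn c u = {w}) :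
      SignedStep P c (blacken c {w})
  /-- If `W_+ = W` or `W_- = W`, color all vertices of `W` black. -/
  | cancel (u : V) (s : Sgn) (hu : P.Applicable c u)
      (hW : P.whiteInSigned c u s = P.whiteIn c u) :
      SignedStep P c (blacken c (P.whiteIn c u))
  /-- If `W_s` is nonempty, `W_{-s}` is empty and `W_* = {w}`, mark `w` with `P_{uw} · (-s)`. -/
  | deduce (u w : V) (s p : Sgn) (hu : P.Applicable c u)
      (hs : (P.whiteInSigned c u s).Nonempty) (hs' : P.whiteInSigned c u (-s) = ∅)
      (hW : P.whiteInUnmarked c u = {w}) (hp : P.entry u w = PatternEntry.sgn p) :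
      SignedStep P c (mark c w (p * -s))
  /-- If no white vertex is marked, mark any white vertex with `+`. -/
  | seed (u : V) (hc : ∀ v t, c v ≠ VertexState.white (some t))
      (hu : c u = VertexState.white none) :
      SignedStep P c (mark c u 1)

/-- The initial state: the vertices of `S` are black, all others are white and unmarked. -/
noncomputable def initialState (S : Set V) : V → VertexState :=
  blacken (fun _ => VertexState.white none) S

/-- Starting from `S`, the signed game can be played so that all vertices become black. -/
def IsForcingSet (P : SignPattern V) (S : Set V) : Prop :=
  Relation.ReflTransGen P.SignedStep (initialState S) (fun _ => VertexState.black)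

/-- The signed zero forcing number `Z_±(P)`. -/
noncomputable def signedZeroForcingNumber (P : SignPattern V) : ℕ :=
  sInf {k | ∃ S : Finset V, P.IsForcingSet (S : Set V) ∧ S.card = k}

end SignPattern

namespace SimpleGraph

variable {V : Type*}

open Classical in
/-- The sign pattern of `G`: `?` on the diagonal, `-` at the edges, `0` at the non-edges. -/
noncomputable def zPattern (G : SimpleGraph V) : SignPattern V where
  entry i j :=
    if i = j then PatternEntry.unknown
    else if G.Adj i j then PatternEntry.sgn (-1)
    else PatternEntry.zero
  fixed_periphery i j h := by
    rw [if_neg h]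
    split_ifs <;> simp

/-- The signed zero forcing number `Z_±(G)` of a graph. -/
noncomputable def signedZeroForcingNumber (G : SimpleGraph V) : ℕ :=
  G.zPattern.signedZeroForcingNumber

end SimpleGraph

/-! ### Initial states of the signed game -/

namespace SignPattern

variable {V : Type*}

/-! A classical force is a signed force, so `Z_±` is at most `Z`. For the reverse, root the tree and
choose `Q` from the leaves upward: a vertex belongs to `Q` when at least two of its children do not.
Removing `Q` leaves descending paths. Assign to each `q` in `Q` one path starting at a child `b q`;
the lower ends of the remaining paths form a zero forcing set (`isZeroForcingSet_pathEnds`), of size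
at most the number of paths minus `|Q|`. No smaller set `S` wins the signed game. Requiring a real
vector to vanish on `S` and on `Q`, to be constant along each path and to have zero neighbour sum at
each vertex of `Q` leaves a nonzero solution `x` (`exists_ne_zero_of_card_lt`). Every zero of `x`
then has zero neighbour sum. For such a vector, black means zero and markers are weak signs, up to
one global sign, throughout the game (`Compatible.step`); a won game would force `x = 0`. -/

theorem initialState_apply_mem {S : Set V} {v : V} (h : v ∈ S) :
    initialState S v = VertexState.black := by
  simp [initialState, blacken, h]

theorem initialState_apply_notMem {S : Set V} {v : V} (h : v ∉ S) :
    initialState S v = VertexState.white none := by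
  simp [initialState, blacken, h]

theorem initialState_univ : initialState (Set.univ : Set V) = fun _ => VertexState.black := by
  funext v
  exact initialState_apply_mem (Set.mem_univ v)

theorem exists_initialState_eq_white_iff {S : Set V} {v : V} :
    (∃ m, initialState S v = VertexState.white m) ↔ v ∉ S := by
  by_cases h : v ∈ S
  · simp [initialState_apply_mem h, h]
  · simp [initialState_apply_notMem h, h]

theorem blacken_initialState_singleton (S : Set V) (w : V) :
    blacken (initialState S) {w} = initialState (insert w S) := by
  funext v
  by_cases hv : v = w
  · subst hv
    rw [initialState_apply_mem (Set.mem_insert v S)]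
    simp [blacken]
  · have h : blacken (initialState S) {w} v = initialState S v := by simp [blacken, hv]
    rw [h]
    by_cases hS : v ∈ S
    · rw [initialState_apply_mem hS, initialState_apply_mem (Set.mem_insert_of_mem w hS)]
    · rw [initialState_apply_notMem hS, initialState_apply_notMem (by simp [hv, hS])]

end SignPattern

namespace SimpleGraph

open SignPattern

variable {V : Type*} {G : SimpleGraph V}

/-! ### Forts and zero forcing sets -/

theorem zeroForcingStep_univ (D : Set V) : ¬ G.ZeroForcingStep Set.univ D := by
  rintro ⟨u, -, w, hw, -⟩
  have : w ∈ {v | G.Adj u v ∧ v ∉ Set.univ} := hw ▸ Set.mem_singleton w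
  exact this.2 (Set.mem_univ w)

/-- A fort is a set `F` such that no vertex outside `F` has exactly one neighbour in `F`. If no
nonempty fort avoids `S`, then `S` is a zero forcing set. -/
theorem isZeroForcingSet_of_forts [Finite V] {S : Set V}
    (h : ∀ F : Set V, Disjoint F S → (∀ u ∉ F, ∀ w, {v | G.Adj u v ∧ v ∈ F} ≠ {w}) → F = ∅) :
    G.IsZeroForcingSet S := by
  refine ⟨?_, zeroForcingStep_univ⟩
  -- The complement of a maximal reachable black set is a fort: a unique white neighbour of a black
  -- vertex would enlarge the set.
  obtain ⟨B, hB⟩ := (Set.toFinite {B | Relation.ReflTransGen G.ZeroForcingStep S B}).exists_maximal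
    ⟨S, .refl⟩
  have hmono : ∀ B, Relation.ReflTransGen G.ZeroForcingStep S B → S ⊆ B := by
    intro B hB
    induction hB with
    | refl => exact subset_rfl
    | tail _ hs ih =>
      obtain ⟨u, -, w, -, rfl⟩ := hs
      exact ih.trans (Set.subset_insert _ _)
  have hF := h Bᶜ (Set.disjoint_compl_left_iff_subset.2 (hmono B hB.prop)) (by
    intro u hu w hw
    have hwB : w ∈ {v | G.Adj u v ∧ v ∈ Bᶜ} := hw ▸ Set.mem_singleton w
    have hstep : Relation.ReflTransGen G.ZeroForcingStep S (insert w B) :=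
      hB.prop.tail ⟨u, not_not.1 hu, w, hw, rfl⟩
    exact hwB.2 (hB.le_of_ge hstep (Set.subset_insert w B) (Set.mem_insert w B)))
  rw [Set.compl_empty_iff] at hF
  exact hF ▸ hB.prop

/-! ### The signed game on the pattern of a graph -/

theorem zPattern_entry_eq_sgn_iff {u w : V} {s : Sgn} :
    G.zPattern.entry u w = PatternEntry.sgn s ↔ G.Adj u w ∧ s = -1 := by
  unfold zPattern
  by_cases h : u = w
  · simp [h]
  · by_cases h' : G.Adj u w
    · simp [h, h', eq_comm]
    · simp [h, h']

theorem zPattern_arrow_iff {u w : V} : G.zPattern.Arrow w u ↔ G.Adj u w := by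
  simp [Arrow, zPattern_entry_eq_sgn_iff]

theorem zPattern_applicable_iff {c : V → VertexState} {u : V} :
    G.zPattern.Applicable c u ↔ c u = VertexState.black := by
  simp [Applicable, zPattern]

theorem IsZeroForcingSet.isForcingSet_zPattern {S : Set V} (h : G.IsZeroForcingSet S) :
    G.zPattern.IsForcingSet S := by
  unfold IsForcingSet
  rw [← initialState_univ]
  refine Relation.ReflTransGen.lift (p := G.zPattern.SignedStep) initialState ?_ _ _ h.1
  rintro B _ ⟨u, hu, w, hw, rfl⟩
  change G.zPattern.SignedStep (initialState B) (initialState (insert w B))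
  rw [← blacken_initialState_singleton]
  refine .force u w (zPattern_applicable_iff.2 (initialState_apply_mem hu)) ?_
  rw [← hw]
  ext v
  simp only [whiteIn, exists_initialState_eq_white_iff, zPattern_arrow_iff, Set.mem_ofPred_eq]
  exact and_comm

/-- The vector `x` vanishes at the black vertices, and its sign at a marked vertex is (weakly) the
marker. -/
def Compatible (x : V → ℝ) (c : V → VertexState) : Prop :=
  (∀ v, c v = VertexState.black → x v = 0) ∧
    ∀ v (t : Sgn), c v = VertexState.white (some t) → 0 ≤ ((t : ℤ) : ℝ) * x v

theorem Compatible.blacken {x : V → ℝ} {c : V → VertexState} (h : Compatible x c) {A : Set V}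
    (hA : ∀ v ∈ A, x v = 0) : Compatible x (blacken c A) := by
  refine ⟨fun v hv => ?_, fun v t hv => ?_⟩
  · by_cases hvA : v ∈ A
    · exact hA v hvA
    · exact h.1 v (by simpa [SignPattern.blacken, hvA] using hv)
  · by_cases hvA : v ∈ A
    · simp [SignPattern.blacken, hvA] at hv
    · exact h.2 v t (by simpa [SignPattern.blacken, hvA] using hv)

theorem Compatible.mark {x : V → ℝ} {c : V → VertexState} (h : Compatible x c) {w : V} {s : Sgn}
    (hw : 0 ≤ ((s : ℤ) : ℝ) * x w) : Compatible x (mark c w s) := by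
  refine ⟨fun v hv => ?_, fun v t hv => ?_⟩
  · by_cases hvw : v = w
    · simp [SignPattern.mark, hvw] at hv
    · exact h.1 v (by simpa [SignPattern.mark, hvw] using hv)
  · by_cases hvw : v = w
    · subst hvw
      have : s = t := by simpa [SignPattern.mark] using hv
      exact this ▸ hw
    · exact h.2 v t (by simpa [SignPattern.mark, hvw] using hv)

-- Each move reads off what a vanishing neighbour sum implies about signs. Only the seed move may
-- need `-x`.
open Classical in
theorem Compatible.step [Fintype V] {x : V → ℝ} {c c' : V → VertexState} (h : Compatible x c)
    (hx : ∀ u, x u = 0 → ∑ w with G.Adj u w, x w = 0) (hs : G.zPattern.SignedStep c c') :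
    Compatible x c' ∨ Compatible (-x) c' := by
  have hblack : ∀ u v, G.Adj u v → v ∉ G.zPattern.whiteIn c u → x v = 0 := by
    intro u v huv hv
    refine h.1 v ?_
    cases hcv : c v with
    | black => rfl
    | white m => exact (hv ⟨⟨m, hcv⟩, zPattern_arrow_iff.2 huv⟩).elim
  cases hs with
  | force u w hu hW =>
    left
    refine h.blacken fun v hv => ?_
    obtain rfl : v = w := hv
    have hsum := hx u (h.1 u (zPattern_applicable_iff.1 hu))
    have hw : v ∈ G.zPattern.whiteIn c u := hW ▸ Set.mem_singleton v
    rw [Finset.sum_eq_single v] at hsum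
    · exact hsum
    · intro v' hv hvw
      refine hblack u v' (Finset.mem_filter.1 hv).2 ?_
      rwa [hW]
    · intro hn
      exact (hn (by simpa using zPattern_arrow_iff.1 hw.2)).elim
  | cancel u s hu hW =>
    left
    refine h.blacken ?_
    have hsum := hx u (h.1 u (zPattern_applicable_iff.1 hu))
    -- All edge entries are `-1`, so membership in `W_s` means marker `-s`: the terms of the zero
    -- sum share a weak sign and all vanish.
    have hnonneg : ∀ v ∈ Finset.univ.filter (G.Adj u), 0 ≤ (((-s : Sgn) : ℤ) : ℝ) * x v := by
      intro v hv
      by_cases hvW : v ∈ G.zPattern.whiteIn c u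
      · obtain ⟨-, t, hct, he⟩ := hW.symm ▸ hvW
        have hst : s * t = -1 := (zPattern_entry_eq_sgn_iff.1 he).2
        have : t = -s := by
          rcases Int.units_eq_one_or s with rfl | rfl <;>
            rcases Int.units_eq_one_or t with rfl | rfl <;> simp_all
        exact this ▸ h.2 v t hct
      · simp [hblack u v (by simpa using hv) hvW]
    have hz := (Finset.sum_eq_zero_iff_of_nonneg hnonneg).1 (by rw [← Finset.mul_sum, hsum, mul_zero])
    intro v hv
    have := hz v (by simpa using zPattern_arrow_iff.1 hv.2)
    rcases Int.units_eq_one_or s with rfl | rfl <;> simpa using this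
  | deduce u w s p hu hs hs' hW hp =>
    left
    obtain ⟨huw, rfl⟩ := zPattern_entry_eq_sgn_iff.1 hp
    refine h.mark ?_
    have hsum := hx u (h.1 u (zPattern_applicable_iff.1 hu))
    rw [← Finset.add_sum_erase _ _ (show w ∈ Finset.univ.filter (G.Adj u) by simpa using huw)]
      at hsum
    have hnonneg : 0 ≤ ∑ v ∈ (Finset.univ.filter (G.Adj u)).erase w,
        (((-s : Sgn) : ℤ) : ℝ) * x v := by
      refine Finset.sum_nonneg fun v hv => ?_
      rw [Finset.mem_erase, Finset.mem_filter] at hv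
      by_cases hvW : v ∈ G.zPattern.whiteIn c u
      · obtain ⟨m, hm⟩ := hvW.1
        cases m with
        | none =>
          have : v ∈ G.zPattern.whiteInUnmarked c u := ⟨hvW, hm⟩
          rw [hW] at this
          exact (hv.1 this).elim
        | some t =>
          have hn : v ∉ G.zPattern.whiteInSigned c u (-s) := by simp [hs']
          have : t = -s := by
            by_contra hts
            refine hn ⟨hvW, t, hm, zPattern_entry_eq_sgn_iff.2 ⟨hv.2.2, ?_⟩⟩
            rcases Int.units_eq_one_or s with rfl | rfl <;>
              rcases Int.units_eq_one_or t with rfl | rfl <;> simp_all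
          exact this ▸ h.2 v t hm
      · simp [hblack u v hv.2.2 hvW]
    -- The other terms have weak sign `-s`, so `x w` has weak sign `s`, which is the marker `-1 *
    -- -s`.
    rw [← Finset.mul_sum] at hnonneg
    rcases Int.units_eq_one_or s with rfl | rfl <;> push_cast at hnonneg ⊢ <;> linarith
  | seed u hc hu =>
    have key : ∀ y : V → ℝ, Compatible y c → 0 ≤ y u → Compatible y (SignPattern.mark c u 1) :=
      fun y hy hyu => hy.mark (by simpa using hyu)
    rcases le_total 0 (x u) with h0 | h0
    · exact .inl (key x h h0)
    -- With no marker present, compatibility is insensitive to negating `x`.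
    · refine .inr (key (-x) ⟨fun v hv => by simp [h.1 v hv], fun v t hv => (hc v t hv).elim⟩ ?_)
      simpa using h0

open Classical in
/-- If a vector vanishes on a forcing set, and its sum over the neighbours of each of its zeros
vanishes, then it is zero. -/
theorem eq_zero_of_isForcingSet_zPattern [Fintype V] {x : V → ℝ} {S : Set V}
    (hS : G.zPattern.IsForcingSet S) (hxS : ∀ v ∈ S, x v = 0)
    (hx : ∀ u, x u = 0 → ∑ w with G.Adj u w, x w = 0) : x = 0 := by
  have hx' : ∀ u, (-x) u = 0 → ∑ w with G.Adj u w, (-x) w = 0 := by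
    intro u hu
    simp only [Pi.neg_apply, Finset.sum_neg_distrib, neg_eq_zero] at hu ⊢
    exact hx u hu
  have key : ∀ c, Relation.ReflTransGen G.zPattern.SignedStep (initialState S) c →
      Compatible x c ∨ Compatible (-x) c := by
    intro c hc
    induction hc with
    | refl =>
      refine .inl ⟨fun v hv => hxS v ?_, fun v t hv => ?_⟩
      · by_contra hvS
        simp [initialState_apply_notMem hvS] at hv
      · by_cases hvS : v ∈ S
        · simp [initialState_apply_mem hvS] at hv
        · simp [initialState_apply_notMem hvS] at hv
    | tail _ hs ih =>
      rcases ih with ih | ih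
      · exact ih.step hx hs
      · simpa [or_comm] using ih.step hx' hs
  funext v
  rcases key _ hS with h | h
  · exact h.1 v rfl
  · simpa using h.1 v rfl

/-! ### Rooted forests -/

/-- `par p c` says that `p` is the parent of `c` in a rooted forest on the graph `G`; the function
`d` increases from parents to children. -/
structure IsRooting (G : SimpleGraph V) (par : V → V → Prop) (d : V → ℕ) : Prop where
  adj_iff : ∀ u v, G.Adj u v ↔ par u v ∨ par v u
  unique : ∀ {p q c}, par p c → par q c → p = q
  lt : ∀ {p c}, par p c → d p < d c

/-- Parents are unique because geodesics from `r` through two parents of `c` extend to paths from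
`r` to `c`, and a tree has only one. -/
theorem IsTree.isRooting (hG : G.IsTree) (r : V) :
    G.IsRooting (fun p c => G.Adj p c ∧ G.dist r c = G.dist r p + 1) (G.dist r) where
  adj_iff u v := by
    refine ⟨fun h => ?_, fun h => h.elim And.left fun h => h.1.symm⟩
    rcases hG.dist_eq_dist_add_one_of_adj r h with h' | h'
    · exact .inr ⟨h.symm, h'⟩
    · exact .inl ⟨h, h'⟩
  unique := by
    rintro p q c ⟨hp, hp'⟩ ⟨hq, hq'⟩
    obtain ⟨P, hP⟩ := hG.connected.exists_walk_length_eq_dist r p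
    obtain ⟨Q, hQ⟩ := hG.connected.exists_walk_length_eq_dist r q
    have hP' : (P.concat hp).IsPath := Walk.isPath_of_length_eq_dist _ (by simp [hP, hp'])
    have hQ' : (Q.concat hq).IsPath := Walk.isPath_of_length_eq_dist _ (by simp [hQ, hq'])
    have := congrArg Walk.penultimate ((hG.existsUnique_path r c).unique hP' hQ')
    simpa using this
  lt h := by omega

theorem wellFounded_invImage_gt [Finite V] (d : V → ℕ) :
    WellFounded (fun c p : V => d p < d c) :=
  have : IsTrans V (fun c p : V => d p < d c) := ⟨fun _ _ _ h₁ h₂ => h₂.trans h₁⟩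
  have : Std.Irrefl (fun c p : V => d p < d c) := ⟨fun _ => lt_irrefl _⟩
  Finite.wellFounded_of_trans_of_irrefl _

namespace IsRooting

variable {par : V → V → Prop} {d : V → ℕ}

theorem wellFounded_child [Finite V] (h : G.IsRooting par d) :
    WellFounded (fun c p => par p c) :=
  Subrelation.wf (fun h' => h.lt h') (wellFounded_invImage_gt d)

/-- There is a set of branch vertices: those with at least two children outside the set. -/
theorem exists_branch [Finite V] (h : G.IsRooting par d) : ∃ Q : V → Prop,
    ∀ v, Q v ↔ ∃ a b, a ≠ b ∧ (par v a ∧ ¬ Q a) ∧ (par v b ∧ ¬ Q b) := by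
  -- Membership depends only on the children, so recursion from the leaves upward defines the set.
  refine ⟨h.wellFounded_child.fix fun v ih => ∃ a b, a ≠ b ∧ (∃ ha : par v a, ¬ ih a ha) ∧
    (∃ hb : par v b, ¬ ih b hb), fun v => ?_⟩
  rw [WellFounded.fix_eq]
  simp only [exists_prop]

end IsRooting

/-! ### Decomposition into descending paths -/

/-- The vertices reached from the vertices `b q`, with `q` in `Q`, by descending outside `Q`. -/
inductive Descends (par : V → V → Prop) (Q : V → Prop) (b : V → V) : V → Prop
  | base {q : V} : Q q → Descends par Q b (b q)
  | step {p c : V} : Descends par Q b p → par p c → ¬ Q c → Descends par Q b c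

/-- The lower ends of the paths outside `Q` that do not start at a vertex `b q`. -/
def pathEnds (par : V → V → Prop) (Q : V → Prop) (b : V → V) : Set V :=
  {v | ¬ Q v ∧ ¬ Descends par Q b v ∧ ∀ c, par v c → Q c}

/-- The vertices outside `Q` whose parent exists and is outside `Q`. -/
def nonTops (par : V → V → Prop) (Q : V → Prop) : Set V :=
  {v | ¬ Q v ∧ ∃ p, par p v ∧ ¬ Q p}

/-- Every vertex of `Q` has the two distinct children `a q` and `b q` outside `Q`, and every other
vertex has at most one child outside `Q`. -/
structure IsBranching (par : V → V → Prop) (Q : V → Prop) (a b : V → V) : Prop where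
  eq_of_notMem : ∀ {v c c'}, ¬ Q v → par v c → ¬ Q c → par v c' → ¬ Q c' → c = c'
  ne : ∀ {q}, Q q → a q ≠ b q
  left : ∀ {q}, Q q → par q (a q) ∧ ¬ Q (a q)
  right : ∀ {q}, Q q → par q (b q) ∧ ¬ Q (b q)

theorem IsRooting.exists_isBranching [Finite V] {par : V → V → Prop} {d : V → ℕ}
    (h : G.IsRooting par d) : ∃ Q a b, IsBranching par Q a b := by
  obtain ⟨Q, hQ⟩ := h.exists_branch
  have hab := fun v => (hQ v).1
  choose! a b hab using hab
  refine ⟨Q, a, b, fun {v c c'} hv hc hcQ hc' hcQ' => ?_, fun hq => (hab _ hq).1,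
    fun hq => (hab _ hq).2.1, fun hq => (hab _ hq).2.2⟩
  by_contra hne
  exact hv ((hQ v).2 ⟨c, c', hne, ⟨hc, hcQ⟩, hc', hcQ'⟩)

/-! ### Path ends: forcing, counting and the lower bound -/

namespace IsBranching

variable {par : V → V → Prop} {d : V → ℕ} {Q : V → Prop} {a b : V → V}

theorem notMem_of_descends (hB : IsBranching par Q a b) {v : V} (hv : Descends par Q b v) :
    ¬ Q v := by
  cases hv with
  | base hq => exact (hB.right hq).2
  | step _ _ hc => exact hc

theorem descends_parent (hB : IsBranching par Q a b) (h : G.IsRooting par d) {p c : V}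
    (hpc : par p c) (hc : Descends par Q b c) : (Q p ∧ c = b p) ∨ Descends par Q b p := by
  cases hc with
  | base hq =>
    obtain rfl := h.unique hpc (hB.right hq).1
    exact .inl ⟨hq, rfl⟩
  | step hp' hpc' _ =>
    obtain rfl := h.unique hpc hpc'
    exact .inr hp'

/-- A fort avoiding the path ends is emptied in two passes. Going up, each vertex off the `Descends`
paths is a path end or is forced by a child: `a v` if `v` is in `Q`, its path child otherwise. Going
down, `q` forces `b q`, and each path vertex then forces the next. -/
theorem isZeroForcingSet_pathEnds [Finite V] (hB : IsBranching par Q a b)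
    (h : G.IsRooting par d) : G.IsZeroForcingSet (pathEnds par Q b) := by
  refine isZeroForcingSet_of_forts fun F hF hfort => ?_
  have hforce : ∀ u w, u ∉ F → par u w ∨ par w u → (∀ v, par u v → v ≠ w → v ∉ F) →
      (∀ v, par v u → v ≠ w → v ∉ F) → w ∉ F := by
    intro u w hu huw hc hp hw
    refine hfort u hu w (Set.ext fun v => ⟨fun hvF => ?_, ?_⟩)
    · by_contra hvw
      rcases (h.adj_iff _ _).1 hvF.1 with h' | h'
      · exact hc v h' hvw hvF.2
      · exact hp v h' hvw hvF.2
    · rintro rfl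
      exact ⟨(h.adj_iff _ _).2 huw, hw⟩
  have hup : ∀ v, ¬ Descends par Q b v → v ∉ F := by
    intro v
    -- Upward pass: vertices of larger `d` are already excluded from `F`.
    induction v using (wellFounded_invImage_gt d).induction with
    | _ v ih =>
      intro hv
      have hchild : ∀ {c}, par v c → ¬ Descends par Q b c → ¬ Q c → v ∉ F := by
        intro c hvc hc hcQ
        refine hforce c v (ih c (h.lt hvc) hc) (.inr hvc) (fun e hce _ => ?_)
          fun e hec hev => (hev (h.unique hec hvc)).elim
        refine ih e ((h.lt hvc).trans (h.lt hce)) fun hde => ?_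
        exact (hB.descends_parent h hce hde).elim (fun h' => hcQ h'.1) hc
      by_cases hvQ : Q v
      · refine hchild (hB.left hvQ).1 (fun hd => ?_) (hB.left hvQ).2
        exact (hB.descends_parent h (hB.left hvQ).1 hd).elim (fun h' => hB.ne hvQ h'.2) hv
      · by_cases hvc : ∃ c, par v c ∧ ¬ Q c
        · obtain ⟨c, hvc, hcQ⟩ := hvc
          refine hchild hvc (fun hd => ?_) hcQ
          exact (hB.descends_parent h hvc hd).elim (fun h' => hvQ h'.1) hv
        · push Not at hvc
          exact fun hvF => Set.disjoint_left.1 hF hvF ⟨hvQ, hv, hvc⟩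
  refine Set.eq_empty_of_forall_notMem fun v => ?_
  -- Downward pass: vertices of smaller `d` are already excluded from `F`.
  induction v using (measure d).wf.induction with
  | _ v ih =>
    by_cases hv : Descends par Q b v
    · cases hv with
      | @base q hq =>
        have hqd : ¬ Descends par Q b q := fun hd => hB.notMem_of_descends hd hq
        have hlt := h.lt (hB.right hq).1
        refine hforce q _ (hup q hqd) (.inl (hB.right hq).1) (fun e hqe he => ?_)
          fun e heq _ => ih e ((h.lt heq).trans hlt)
        exact hup e fun hd => (hB.descends_parent h hqe hd).elim (fun h' => he h'.2) hqd
      | @step p _ hp hpv hvQ =>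
        refine hforce p v (ih p (h.lt hpv)) (.inl hpv) (fun e hpe he => ?_)
          fun e hep _ => ih e ((h.lt hep).trans (h.lt hpv))
        refine hup e fun hd => he ?_
        exact hB.eq_of_notMem (hB.notMem_of_descends hp) hpe (hB.notMem_of_descends hd) hpv hvQ
    · exact hup v hv

/-- On the `Descends` paths, the `|Q|` tops `b q` are disjoint from `nonTops`. On the other paths,
sending a non-top to its parent injects non-tops into vertices that are not lower ends. -/
theorem ncard_pathEnds_add_le [Finite V] (hB : IsBranching par Q a b) (h : G.IsRooting par d) :
    (pathEnds par Q b).ncard + 2 * {v | Q v}.ncard + (nonTops par Q).ncard ≤ Nat.card V := by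
  have hV : {v | Q v}.ncard + {v | ¬ Q v}.ncard = Nat.card V := Set.ncard_add_ncard_compl _
  have hsplit : {v | ¬ Q v ∧ ¬ Descends par Q b v}.ncard + {v | Descends par Q b v}.ncard =
      {v | ¬ Q v}.ncard := by
    rw [← Set.ncard_union_eq (Set.disjoint_left.2 fun v hv hv' => hv.2 hv')]
    congr 1
    ext v
    have : Descends par Q b v → ¬ Q v := hB.notMem_of_descends
    simp only [Set.mem_union, Set.mem_ofPred_eq]
    tauto
  have hgood : (pathEnds par Q b).ncard +
      {v | (¬ Q v ∧ ¬ Descends par Q b v) ∧ ∃ c, par v c ∧ ¬ Q c}.ncard =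
      {v | ¬ Q v ∧ ¬ Descends par Q b v}.ncard := by
    rw [← Set.ncard_union_eq (Set.disjoint_left.2 fun v hv hv' => by
      obtain ⟨c, hc, hcQ⟩ := hv'.2
      exact hcQ (hv.2.2 c hc))]
    congr 1
    ext v
    have : (∃ c, par v c ∧ ¬ Q c) ↔ ¬ ∀ c, par v c → Q c := by push Not; rfl
    simp only [pathEnds, Set.mem_union, Set.mem_ofPred_eq, this]
    tauto
  have hnon : (nonTops par Q \ {v | Descends par Q b v}).ncard +
      (nonTops par Q ∩ {v | Descends par Q b v}).ncard = (nonTops par Q).ncard := by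
    rw [add_comm, Set.ncard_inter_add_ncard_sdiff_eq_ncard]
  have hdesc : {v | Q v}.ncard + (nonTops par Q ∩ {v | Descends par Q b v}).ncard ≤
      {v | Descends par Q b v}.ncard := by
    have hinj : Set.InjOn b {v | Q v} := fun q hq q' hq' he =>
      h.unique (hB.right hq).1 (he ▸ (hB.right hq').1)
    rw [← hinj.ncard_image, ← Set.ncard_union_eq]
    · refine Set.ncard_le_ncard (Set.union_subset ?_ Set.inter_subset_right)
      rintro _ ⟨q, hq, rfl⟩
      exact .base hq
    · refine Set.disjoint_left.2 ?_
      rintro _ ⟨q, hq, rfl⟩ ⟨⟨-, p, hp, hpQ⟩, -⟩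
      exact hpQ (h.unique hp (hB.right hq).1 ▸ hq)
  have hpar : (nonTops par Q \ {v | Descends par Q b v}).ncard ≤
      {v | (¬ Q v ∧ ¬ Descends par Q b v) ∧ ∃ c, par v c ∧ ¬ Q c}.ncard := by
    have hπ : ∀ v, v ∈ nonTops par Q → ∃ p, par p v ∧ ¬ Q p := fun v hv => hv.2
    choose! π hπ using hπ
    refine Set.ncard_le_ncard_of_injOn π (fun v hv => ?_) fun v hv w hw he => ?_
    · have hp := hπ v hv.1
      exact ⟨⟨hp.2, fun hd => hv.2 (Descends.step hd hp.1 hv.1.1)⟩, v, hp.1, hv.1.1⟩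
    · exact hB.eq_of_notMem (hπ v hv.1).2 (hπ v hv.1).1 hv.1.1 (he ▸ (hπ w hw.1).1) hw.1.1
  omega

-- The four blocks of equations number `|S| + 2|Q| + |nonTops| < |V|`. At a zero outside `Q`, each
-- neighbour is in `Q` or on the same path, hence is also a zero.
open Classical in
theorem exists_ne_zero_of_card_lt [Fintype V] (hB : IsBranching par Q a b)
    (h : G.IsRooting par d) {S : Finset V} (hS : S.card < (pathEnds par Q b).ncard) :
    ∃ x : V → ℝ, x ≠ 0 ∧ (∀ v ∈ S, x v = 0) ∧
      ∀ u, x u = 0 → ∑ w with G.Adj u w, x w = 0 := by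
  have hπ : ∀ v, v ∈ nonTops par Q → ∃ p, par p v ∧ ¬ Q p := fun v hv => hv.2
  choose! π hπ using hπ
  let pr : V → (V → ℝ) →ₗ[ℝ] ℝ := fun v => LinearMap.proj v
  let f : (V → ℝ) →ₗ[ℝ] (S ⊕ {v // Q v} ⊕ {v // Q v} ⊕ nonTops par Q) → ℝ :=
    LinearMap.pi (Sum.elim (fun v => pr v) (Sum.elim (fun v => pr v)
      (Sum.elim (fun v => ∑ w with G.Adj v.1 w, pr w) (fun v => pr v - pr (π v)))))
  have hker : LinearMap.ker f ≠ ⊥ := by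
    refine LinearMap.ker_ne_bot_of_finrank_lt ?_
    have hcard := hB.ncard_pathEnds_add_le h
    have hQ : Fintype.card {v // Q v} = {v | Q v}.ncard := by
      rw [← Nat.card_eq_fintype_card]; rfl
    have hN : Fintype.card (nonTops par Q) = (nonTops par Q).ncard := by
      rw [← Nat.card_eq_fintype_card]; rfl
    rw [Nat.card_eq_fintype_card] at hcard
    simp only [Module.finrank_fintype_fun_eq_card, Fintype.card_sum, Fintype.card_coe, hQ, hN]
    omega
  obtain ⟨x, hx, hx0⟩ := Submodule.exists_mem_ne_zero_of_ne_bot hker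
  have hx' : ∀ i, f x i = 0 := fun i => congrFun (LinearMap.mem_ker.1 hx) i
  have hxQ : ∀ v, Q v → x v = 0 := fun v hv => hx' (.inr (.inl ⟨v, hv⟩))
  have hxpar : ∀ p v, par p v → ¬ Q p → ¬ Q v → x v = x p := by
    intro p v hpv hp hv
    have hvN : v ∈ nonTops par Q := ⟨hv, p, hpv, hp⟩
    obtain rfl := h.unique hpv (hπ v hvN).1
    exact sub_eq_zero.1 (hx' (.inr (.inr (.inr ⟨v, hvN⟩))))
  refine ⟨x, hx0, fun v hv => hx' (.inl ⟨v, hv⟩), fun u hu => ?_⟩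
  by_cases huQ : Q u
  · simpa [f, pr] using hx' (.inr (.inr (.inl ⟨u, huQ⟩)))
  · refine Finset.sum_eq_zero fun w hw => ?_
    by_cases hwQ : Q w
    · exact hxQ w hwQ
    · rcases (h.adj_iff _ _).1 (Finset.mem_filter.1 hw).2 with h' | h'
      · rw [hxpar u w h' huQ hwQ, hu]
      · rw [← hxpar w u h' hwQ huQ, hu]

theorem ncard_pathEnds_le [Finite V] (hB : IsBranching par Q a b) (h : G.IsRooting par d)
    {S : Finset V} (hS : G.zPattern.IsForcingSet (S : Set V)) :
    (pathEnds par Q b).ncard ≤ S.card := by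
  have := Fintype.ofFinite V
  by_contra! hlt
  obtain ⟨x, hx0, hxS, hx⟩ := hB.exists_ne_zero_of_card_lt h hlt
  exact hx0 (eq_zero_of_isForcingSet_zPattern hS hxS (by convert hx))

end IsBranching

end SimpleGraph

/-! ### The equality for trees -/

open SimpleGraph in
theorem theorem7p1 {V : Type*} [Finite V] (T : SimpleGraph V) (hT : T.IsTree) :
    T.signedZeroForcingNumber = T.zeroForcingNumber := by
  obtain ⟨r⟩ := hT.connected.nonempty
  have hr := hT.isRooting r
  obtain ⟨Q, a, b, hB⟩ := hr.exists_isBranching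
  have hfin := Set.toFinite
    (pathEnds (fun p c => T.Adj p c ∧ T.dist r c = T.dist r p + 1) Q b)
  have hZ : T.IsZeroForcingSet (hfin.toFinset : Set V) := by
    rw [hfin.coe_toFinset]
    exact hB.isZeroForcingSet_pathEnds hr
  -- Nonemptiness matters: `sInf ∅ = 0` in `ℕ`.
  have hne : {k | ∃ S : Finset V, T.IsZeroForcingSet (S : Set V) ∧ S.card = k}.Nonempty :=
    ⟨_, _, hZ, rfl⟩
  have hle : ∀ {k}, (∃ S : Finset V, T.IsZeroForcingSet (S : Set V) ∧ S.card = k) →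
      ∃ S : Finset V, T.zPattern.IsForcingSet (S : Set V) ∧ S.card = k :=
    fun ⟨S, hS, hk⟩ => ⟨S, hS.isForcingSet_zPattern, hk⟩
  apply le_antisymm
  · exact Nat.sInf_le (hle (Nat.sInf_mem hne))
  · refine le_trans (b := hfin.toFinset.card) (Nat.sInf_le ⟨_, hZ, rfl⟩)
      (le_csInf (hne.mono fun _ => hle) ?_)
    rintro _ ⟨S, hS, rfl⟩
    rw [← Set.ncard_eq_toFinset_card _ hfin]
    exact hB.ncard_pathEnds_le hr hS
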